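/- Theorem 7.5 ("Cylinder"). One-dimensional connected choice $\mathsf{ConC}_1$ is not a cylinder, i.e. $\mathsf{ConC}_1$ is not strongly Weihrauch equivalent to $\mathrm{id}\times\mathsf{ConC}_1$; more precisely, $\mathrm{id}\times\mathsf{ConC}_1$ is not strongly Weihrauch reducible to $\mathsf{ConC}_1$. Here $\mathsf{ConC}_1$ is the multi-valued partial function that maps each non-empty connected closed set $A\subseteq[0,1]$ to an arbitrary point of $A$. The input $A$ is given by negative information: a name of $A$ is a $p\in\mathbb N^{\mathbb N}$ such that $A=[0,1]\setminus\bigcup_{i}B_{p(i)}$, where $(B_n)_n$ is a standard enumeration of the open balls of $[0,1]$ with rational center and rational radius (including the empty ball). Points of $[0,1]$ are given by the Cauchy representation, i.e. by rapidly converging sequences of rational points of $[0,1]$. Moreover, $\mathrm{id}$ is the identity of Baire space $\mathbb N^{\mathbb N}$, represented by itself, and $(f\times g)(x,z)=f(x)\times g(z)$, where a name of a pair is a pair $\langle p,q\rangle$ of names with $\langle p,q\rangle(2n)=p(n)$ and $\langle p,q\rangle(2n+1)=q(n)$. A partial function $F$ on $\mathbb N^{\mathbb N}$ is a realizer of a multi-valued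 partial function $f$ on represented spaces if, for every name $p$ of a point $x$ in the domain of $f$, $F(p)$ is defined and is a name of a point of $f(x)$; and $f$ is strongly Weihrauch reducible to $g$ if there are computable partial functions $K,H$ on $\mathbb N^{\mathbb N}$ such that $K\circ G\circ H$ is a realizer of $f$ for every realizer $G$ of $g$. Strong Weihrauch equivalence means strong Weihrauch reducibility in both directions. -/

import Mathlib

namespace ComputableAnalysis

/-- Baire space. -/
abbrev Baire : Type := ℕ → ℕ

/-- Standard pairing of Baire space: `⟨p,q⟩(2n) = p(n)` and `⟨p,q⟩(2n+1) = q(n)`. -/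
def pair (p q : Baire) : Baire := fun n => if n % 2 = 0 then p (n / 2) else q (n / 2)

/-- The functionals `Ψ : (p, n) ↦ Ψ p n` that are partial recursive in the number argument `n`
uniformly in the oracle `p`: the uniform version of Mathlib's `Nat.RecursiveIn`, in which one
scheme has to work for all oracles. -/
inductive PartrecFunctional : (Baire → ℕ →. ℕ) → Prop
  | zero : PartrecFunctional fun _ _ => Part.some 0
  | succ : PartrecFunctional fun _ n => Part.some (n + 1)
  | left : PartrecFunctional fun _ n => Part.some (Nat.unpair n).1
  | right : PartrecFunctional fun _ n => Part.some (Nat.unpair n).2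
  | oracle : PartrecFunctional fun p n => Part.some (p n)
  | pair {f g : Baire → ℕ →. ℕ} (hf : PartrecFunctional f) (hg : PartrecFunctional g) :
      PartrecFunctional fun p n => do
        let a ← f p n
        let b ← g p n
        Part.some (Nat.pair a b)
  | comp {f g : Baire → ℕ →. ℕ} (hf : PartrecFunctional f) (hg : PartrecFunctional g) :
      PartrecFunctional fun p n => g p n >>= f p
  | prec {f g : Baire → ℕ →. ℕ} (hf : PartrecFunctional f) (hg : PartrecFunctional g) :
      PartrecFunctional fun p n =>
        (Nat.unpair n).2.rec (f p (Nat.unpair n).1) fun y ih => do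
          let i ← ih
          g p (Nat.pair (Nat.unpair n).1 (Nat.pair y i))
  | rfind {f : Baire → ℕ →. ℕ} (hf : PartrecFunctional f) :
      PartrecFunctional fun p n =>
        Nat.rfind fun m => (fun k => decide (k = 0)) <$> f p (Nat.pair n m)

/-- A partial function on Baire space is computable if some oracle computation produces from the
oracle `p` and the position `n` the value `F(p)(n)`; the domain consists of those `p` for which
the computation halts at all positions. -/
def ComputableFun (F : Baire →. Baire) : Prop :=
  ∃ Ψ : Baire → ℕ →. ℕ, PartrecFunctional Ψ ∧ ∀ p q : Baire, q ∈ F p ↔ ∀ n, q n ∈ Ψ p n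

/-- A represented space: a set `X` with a surjective partial map from Baire space onto it.
The partial map is given by its graph: `IsName p x` says that it is defined on `p` with
value `x`. -/
class Represented (X : Type*) where
  IsName : Baire → X → Prop
  unique : ∀ {p x y}, IsName p x → IsName p y → x = y
  surjective : ∀ x, ∃ p, IsName p x

open Represented (IsName)

/-- Multi-valued partial functions; the domain consists of the points with nonempty value. -/
abbrev MultiFun (X Y : Type*) := X → Set Y

/-- `F ⊢ f`: the partial function `F` is a realizer of `f`, i.e. for each name `p` of a point `x`
in the domain of `f`, `F(p)` is defined and is a name of a point of `f(x)`. -/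
def Realizes {X Y : Type*} [Represented X] [Represented Y]
    (F : Baire →. Baire) (f : MultiFun X Y) : Prop :=
  ∀ p x, IsName p x → (f x).Nonempty → ∃ q ∈ F p, ∃ y ∈ f x, IsName q y

/-- Strong Weihrauch reducibility. -/
def StrongWeihrauchLE {X Y Z W : Type*} [Represented X] [Represented Y] [Represented Z]
    [Represented W] (f : MultiFun X Y) (g : MultiFun Z W) : Prop :=
  ∃ K H : Baire →. Baire, ComputableFun K ∧ ComputableFun H ∧
    ∀ G : Baire →. Baire, Realizes G g → Realizes (K.comp (G.comp H)) f

/-- Strong Weihrauch equivalence. -/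
def StrongWeihrauchEquiv {X Y Z W : Type*} [Represented X] [Represented Y] [Represented Z]
    [Represented W] (f : MultiFun X Y) (g : MultiFun Z W) : Prop :=
  StrongWeihrauchLE f g ∧ StrongWeihrauchLE g f

/-- The product of multi-valued functions. -/
def MultiFun.prod {X Y Z W : Type*} (f : MultiFun X Y) (g : MultiFun Z W) :
    MultiFun (X × Z) (Y × W) :=
  fun x => f x.1 ×ˢ g x.2

/-- Baire space is represented by the identity. -/
instance : Represented Baire where
  IsName p x := p = x
  unique h h' := h.symm.trans h'
  surjective x := ⟨x, rfl⟩

/-- The identity of Baire space. -/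
def idBaire : MultiFun Baire Baire := fun p => {p}

theorem pair_even (p q : Baire) (n : ℕ) : pair p q (2 * n) = p n := by
  simp [pair]

theorem pair_odd (p q : Baire) (n : ℕ) : pair p q (2 * n + 1) = q n := by
  have h : (2 * n + 1) / 2 = n := by omega
  simp [pair, h, Nat.add_mod]

/-- The product representation: `⟨p,q⟩` is a name of `(x,y)` if `p` is a name of `x` and
`q` is a name of `y`. -/
instance {X Y : Type*} [Represented X] [Represented Y] : Represented (X × Y) where
  IsName r z := ∃ p q, r = pair p q ∧ IsName p z.1 ∧ IsName q z.2
  unique := by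
    rintro r z z' ⟨p, q, rfl, h1, h2⟩ ⟨p', q', h, h1', h2'⟩
    have hp : p = p' := by
      funext n
      rw [← pair_even p q n, h, pair_even]
    have hq : q = q' := by
      funext n
      rw [← pair_odd p q n, h, pair_odd]
    subst hp hq
    exact Prod.ext (Represented.unique h1 h1') (Represented.unique h2 h2')
  surjective z := by
    obtain ⟨p, hp⟩ := Represented.surjective z.1
    obtain ⟨q, hq⟩ := Represented.surjective z.2
    exact ⟨pair p q, p, q, rfl, hp, hq⟩

/-- A multi-valued function `f` is a cylinder if it is strongly Weihrauch equivalent to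
`id × f`. -/
def IsCylinder {X Y : Type*} [Represented X] [Represented Y] (f : MultiFun X Y) : Prop :=
  StrongWeihrauchEquiv f (idBaire.prod f)

/-- The standard numbering of the nonnegative rationals, `⟨a,b⟩ ↦ a / (b + 1)`. -/
noncomputable def ratio (k : ℕ) : ℝ := (Nat.unpair k).1 / ((Nat.unpair k).2 + 1)

theorem ratio_nonneg (k : ℕ) : 0 ≤ ratio k := by
  unfold ratio
  positivity

theorem exists_ratio_between {a b : ℝ} (ha : 0 ≤ a) (hab : a < b) :
    ∃ k, a < ratio k ∧ ratio k < b := by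
  obtain ⟨q, hq1, hq2⟩ := exists_rat_btwn hab
  have hq0 : 0 < q := by exact_mod_cast ha.trans_lt hq1
  have hk : ratio (Nat.pair q.num.toNat (q.den - 1)) = (q : ℝ) := by
    have h1 : ((q.num.toNat : ℕ) : ℝ) = (q.num : ℝ) := by
      exact_mod_cast Int.toNat_of_nonneg (Rat.num_nonneg.2 hq0.le)
    have h2 : ((q.den - 1 : ℕ) : ℝ) + 1 = (q.den : ℝ) := by
      exact_mod_cast Nat.sub_add_cancel q.pos
    simp only [ratio, Nat.unpair_pair]
    rw [h1, h2]
    exact (Rat.cast_def q).symm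
  exact ⟨_, by rwa [hk], by rwa [hk]⟩

/-- The standard numbering of the rational points of `[0,1]`, `⟨a,b⟩ ↦ min (a / (b + 1)) 1`. -/
noncomputable def ratPoint (k : ℕ) : unitInterval :=
  ⟨min (ratio k) 1, le_min (ratio_nonneg k) zero_le_one, min_le_right _ _⟩

theorem denseRange_ratPoint : DenseRange ratPoint := by
  rw [DenseRange, Metric.dense_iff]
  intro x r hr
  obtain ⟨k, hk1, hk2⟩ := exists_ratio_between x.2.1 (lt_add_of_pos_right (x : ℝ) hr)
  refine ⟨ratPoint k, ?_, k, rfl⟩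
  have hx := x.2.2
  rw [Metric.mem_ball, Subtype.dist_eq, Real.dist_eq, abs_lt]
  have h1 : (x : ℝ) ≤ min (ratio k) 1 := le_min hk1.le hx
  have h2 : min (ratio k) 1 ≤ ratio k := min_le_left _ _
  constructor <;> simp only [ratPoint] <;> linarith

/-- The Cauchy representation of `[0,1]`: a name of `x` is a sequence of (indices of) rational
points of `[0,1]` that converges rapidly to `x`. -/
noncomputable instance : Represented unitInterval where
  IsName p x :=
    (∀ i k, i ≤ k → dist (ratPoint (p i)) (ratPoint (p k)) ≤ (1 / 2 : ℝ) ^ i) ∧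
      Filter.Tendsto (fun i => ratPoint (p i)) Filter.atTop (nhds x)
  unique h h' := tendsto_nhds_unique h.2 h'.2
  surjective x := by
    have h : ∀ i : ℕ, ∃ k, dist x (ratPoint k) < (1 / 2 : ℝ) ^ (i + 1) := fun i =>
      denseRange_ratPoint.exists_dist_lt x (by positivity)
    choose p hp using h
    refine ⟨p, fun i k hik => ?_, ?_⟩
    · have h1 : (1 / 2 : ℝ) ^ (k + 1) ≤ (1 / 2 : ℝ) ^ (i + 1) :=
        pow_le_pow_of_le_one (by norm_num) (by norm_num) (by omega)
      have h2 := dist_triangle_left (ratPoint (p i)) (ratPoint (p k)) x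
      have h3 := hp i
      have h4 := hp k
      have h5 : (1 / 2 : ℝ) ^ (i + 1) = (1 / 2 : ℝ) ^ i / 2 := by ring
      linarith
    · rw [tendsto_iff_dist_tendsto_zero]
      refine squeeze_zero (fun _ => dist_nonneg) (fun i => ?_)
        ((tendsto_pow_atTop_nhds_zero_of_lt_one (r := (1 / 2 : ℝ)) (by norm_num)
          (by norm_num)).comp (Filter.tendsto_add_atTop_nat 1))
      rw [dist_comm]
      exact (hp i).le

/-- The standard numbering of the open balls of `[0,1]` with rational center and rational radius
(the radius `0`, i.e. the empty ball, occurs, so that the whole space has a negative name). -/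
noncomputable def ratBall (n : ℕ) : Set unitInterval :=
  Metric.ball (ratPoint (Nat.unpair n).1) (ratio (Nat.unpair n).2)

theorem exists_ratBall {U : Set unitInterval} (hU : IsOpen U) {x : unitInterval} (hx : x ∈ U) :
    ∃ n, x ∈ ratBall n ∧ ratBall n ⊆ U := by
  obtain ⟨ε, hε, hb⟩ := Metric.isOpen_iff.1 hU x hx
  obtain ⟨i, hi⟩ := denseRange_ratPoint.exists_dist_lt x (half_pos hε)
  obtain ⟨k, hk1, hk2⟩ := exists_ratio_between dist_nonneg hi
  refine ⟨Nat.pair i k, ?_, fun y hy => hb ?_⟩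
  · simpa [ratBall] using hk1
  · simp only [ratBall, Nat.unpair_pair, Metric.mem_ball] at hy ⊢
    have := dist_triangle_right y x (ratPoint i)
    linarith

/-- The negative representation of the closed subsets of `[0,1]`: a name of `A` is an enumeration
of rational open balls whose union is the complement of `A`. -/
noncomputable instance : Represented (TopologicalSpace.Closeds unitInterval) where
  IsName p A := (A : Set unitInterval) = (⋃ i, ratBall (p i))ᶜ
  unique h h' := TopologicalSpace.Closeds.ext (h.trans h'.symm)
  surjective A := by
    classical
    have h0 : ratBall 0 = ∅ := by simp [ratBall, ratio]
    refine ⟨fun n => if ratBall n ⊆ (A : Set unitInterval)ᶜ then n else 0, ?_⟩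
    rw [eq_compl_comm]
    apply Set.Subset.antisymm
    · refine Set.iUnion_subset fun n => ?_
      beta_reduce
      split_ifs with h
      · exact h
      · simp [h0]
    · intro x hx
      obtain ⟨n, hn, hs⟩ := exists_ratBall A.isClosed.isOpen_compl hx
      refine Set.mem_iUnion.2 ⟨n, ?_⟩
      beta_reduce
      rwa [if_pos hs]

/-- One-dimensional connected choice: the input is a nonempty connected closed set
`A ⊆ [0,1]`, given by negative information, and the possible outputs are the points of `A`.
(All other closed sets get the empty value, i.e. are outside of the domain.) -/
def ConC₁ : MultiFun (TopologicalSpace.Closeds unitInterval) unitInterval :=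
  fun A => {x | IsConnected (A : Set unitInterval) ∧ x ∈ A}

end ComputableAnalysis

namespace ComputableAnalysis

open Filter Topology TopologicalSpace
open Represented (IsName)

/-- The use principle: a halting computation queries only finitely many values of the oracle. -/
theorem PartrecFunctional.eventually_mem {Ψ : Baire → ℕ →. ℕ} (h : PartrecFunctional Ψ) :
    ∀ {p : Baire} {n v : ℕ}, v ∈ Ψ p n → ∀ᶠ p' in 𝓝 p, v ∈ Ψ p' n := by
  induction h with
  | zero => exact fun h => Eventually.of_forall fun _ => h
  | succ => exact fun h => Eventually.of_forall fun _ => h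
  | left => exact fun h => Eventually.of_forall fun _ => h
  | right => exact fun h => Eventually.of_forall fun _ => h
  | oracle =>
    intro p n v h
    have hc : ∀ᶠ p' : Baire in 𝓝 p, p' n = p n :=
      (continuous_apply n).continuousAt.preimage_mem_nhds
        (mem_nhds_discrete.2 (Set.mem_singleton (p n)))
    filter_upwards [hc] with p' hp'
    rwa [hp']
  | pair hf hg ihf ihg =>
    intro p n v h
    obtain ⟨a, ha, h⟩ := Part.mem_bind_iff.1 h
    obtain ⟨b, hb, h⟩ := Part.mem_bind_iff.1 h
    filter_upwards [ihf ha, ihg hb] with p' ha' hb'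
    exact Part.mem_bind_iff.2 ⟨a, ha', Part.mem_bind_iff.2 ⟨b, hb', h⟩⟩
  | comp hf hg ihf ihg =>
    intro p n v h
    obtain ⟨b, hb, h⟩ := Part.mem_bind_iff.1 h
    filter_upwards [ihg hb, ihf h] with p' hb' h'
    exact Part.mem_bind_iff.2 ⟨b, hb', h'⟩
  | prec hf hg ihf ihg =>
    intro p n
    beta_reduce
    generalize (Nat.unpair n).2 = y
    induction y with
    | zero => exact fun h => ihf h
    | succ y ih =>
      intro v h
      obtain ⟨i, hi, h⟩ := Part.mem_bind_iff.1 h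
      filter_upwards [ih hi, ihg h] with p' hi' h'
      exact Part.mem_bind_iff.2 ⟨i, hi', h'⟩
  | @rfind f hf ihf =>
    intro p n v h
    obtain ⟨h1, h2⟩ := Nat.mem_rfind.1 h
    obtain ⟨a, ha, hav⟩ := (Part.mem_map_iff _).1 h1
    have h3 : ∀ m ∈ Set.Iio v, ∀ᶠ p' in 𝓝 p,
        false ∈ (fun k => decide (k = 0)) <$> f p' (Nat.pair n m) := by
      intro m hm
      obtain ⟨b, hb, hbm⟩ := (Part.mem_map_iff _).1 (h2 hm)
      filter_upwards [ihf hb] with p' hb'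
      exact (Part.mem_map_iff _).2 ⟨b, hb', hbm⟩
    filter_upwards [ihf ha, (eventually_all_finite (Set.finite_Iio v)).2 h3] with p' ha' h3'
    exact Nat.mem_rfind.2 ⟨(Part.mem_map_iff _).2 ⟨a, ha', hav⟩, fun {m} hm => h3' m hm⟩

/-- Computable functions on Baire space are continuous on their domain. -/
theorem ComputableFun.eventually_apply_eq {F : Baire →. Baire} (hF : ComputableFun F)
    {p q : Baire} (hq : q ∈ F p) (n : ℕ) : ∀ᶠ p' in 𝓝 p, ∀ q' ∈ F p', q' n = q n := by
  obtain ⟨Ψ, hΨ, h⟩ := hF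
  filter_upwards [hΨ.eventually_mem ((h p q).1 hq n)] with p' hp' q' hq'
  exact Part.mem_unique ((h p' q').1 hq' n) hp'

theorem pair_left_injective {p q p' q' : Baire} (h : pair p q = pair p' q') : p = p' := by
  funext n
  rw [← pair_even p q n, h, pair_even]

theorem continuous_pair_right (p : Baire) : Continuous (pair p) := by
  refine continuous_pi fun n => ?_
  unfold pair
  split_ifs
  · exact continuous_const
  · exact continuous_apply _

theorem isName_of_dist_le {p : Baire} {x : unitInterval}
    (hp : ∀ i, dist x (ratPoint (p i)) ≤ (1 / 2 : ℝ) ^ (i + 1)) : IsName p x := by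
  refine ⟨fun i k hik => ?_, ?_⟩
  · have h1 : (1 / 2 : ℝ) ^ (k + 1) ≤ (1 / 2 : ℝ) ^ (i + 1) :=
      pow_le_pow_of_le_one (by norm_num) (by norm_num) (by omega)
    have h2 := dist_triangle_left (ratPoint (p i)) (ratPoint (p k)) x
    have h3 := hp i
    have h4 := hp k
    have h5 : (1 / 2 : ℝ) ^ (i + 1) = (1 / 2 : ℝ) ^ i / 2 := by ring
    linarith
  · rw [tendsto_iff_dist_tendsto_zero]
    refine squeeze_zero (fun _ => dist_nonneg) (fun i => ?_)
      ((tendsto_pow_atTop_nhds_zero_of_lt_one (r := (1 / 2 : ℝ)) (by norm_num)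
        (by norm_num)).comp (tendsto_add_atTop_nat 1))
    rw [dist_comm]
    exact hp i

theorem dist_le_of_isName {p : Baire} {x : unitInterval} (h : IsName p x) (i : ℕ) :
    dist (ratPoint (p i)) x ≤ (1 / 2 : ℝ) ^ i :=
  le_of_tendsto (tendsto_const_nhds.dist h.2)
    ((eventually_ge_atTop i).mono fun k hk => h.1 i k hk)

/-- Every point of `[0,1]` has a name at which the Cauchy representation is open. -/
theorem exists_isName_forall_nhds (x : unitInterval) :
    ∃ s : Baire, IsName s x ∧
      ∀ U ∈ 𝓝 s, ∀ᶠ x' in 𝓝 x, ∃ s' ∈ U, IsName s' x' := by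
  classical
  have hd : ∀ (y : unitInterval) (i : ℕ), ∃ k, dist y (ratPoint k) < (1 / 2 : ℝ) ^ (i + 1) :=
    fun y i => denseRange_ratPoint.exists_dist_lt y (by positivity)
  choose s hs using hd
  refine ⟨s x, isName_of_dist_le fun i => (hs x i).le, fun U hU => ?_⟩
  rw [nhds_pi, Filter.mem_pi] at hU
  obtain ⟨I, hI, t, ht, hU⟩ := hU
  have hev : ∀ᶠ x' in 𝓝 x, ∀ i ∈ I, dist x' (ratPoint (s x i)) < (1 / 2 : ℝ) ^ (i + 1) := by
    refine (eventually_all_finite hI).2 fun i _ => ?_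
    exact (continuous_id.dist continuous_const).continuousAt.eventually_lt_const (hs x i)
  filter_upwards [hev] with x' hx'
  refine ⟨fun i => if i ∈ I then s x i else s x' i, hU fun i hi => ?_,
    isName_of_dist_le fun i => ?_⟩
  · simpa [hi] using mem_of_mem_nhds (ht i)
  · by_cases hi : i ∈ I
    · simpa [hi] using (hx' i hi).le
    · simpa [hi] using (hs x' i).le

theorem exists_realizes_ConC₁ : ∃ G : Baire →. Baire, Realizes G ConC₁ := by
  classical
  have h : ∀ p : Baire, ∃ q : Baire, ∀ A : Closeds unitInterval, IsName p A →
      (ConC₁ A).Nonempty → ∃ y ∈ ConC₁ A, IsName q y := by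
    intro p
    by_cases hp : ∃ A : Closeds unitInterval, IsName p A ∧ (ConC₁ A).Nonempty
    · obtain ⟨A, hA, y, hy⟩ := hp
      obtain ⟨q, hq⟩ := Represented.surjective y
      refine ⟨q, fun A' hA' _ => ?_⟩
      obtain rfl := Represented.unique hA hA'
      exact ⟨y, hy, hq⟩
    · exact ⟨p, fun A hA hne => absurd ⟨A, hA, hne⟩ hp⟩
  choose g hg using h
  exact ⟨fun p => Part.some (g p), fun p A hA hne => ⟨g p, Part.mem_some _, hg p A hA hne⟩⟩

open Classical in
/-- A realizer may be changed at one argument to any correct value, and to an arbitrary one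
outside of the names of points of the domain. -/
theorem Realizes.update {X Y : Type*} [Represented X] [Represented Y] {f : MultiFun X Y}
    {G : Baire →. Baire} (hG : Realizes G f) (r : Baire) (v : Part Baire)
    (hv : ∀ x, IsName r x → (f x).Nonempty → ∃ q ∈ v, ∃ y ∈ f x, IsName q y) :
    Realizes (Function.update G r v) f := by
  intro p x hp hx
  by_cases h : p = r
  · subst h
    have hu : Function.update G p v p = v := Function.update_self _ _ _
    exact hu.symm ▸ hv x hp hx
  · have hu : Function.update G r v p = G p := Function.update_of_ne h _ _
    exact hu.symm ▸ hG p x hp hx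

/-- The closed set with a given negative name. -/
theorem exists_isName_closeds (r : Baire) : ∃ B : Closeds unitInterval, IsName r B :=
  ⟨⟨(⋃ i, ratBall (r i))ᶜ, (isOpen_iUnion fun _ => Metric.isOpen_ball).isClosed_compl⟩, rfl⟩

/-- The pointwise form of a strong reduction of `f` to connected choice. -/
theorem exists_connected_of_realizes {X Y : Type*} [Represented X] [Represented Y]
    {f : MultiFun X Y} {K H : Baire →. Baire}
    (h : ∀ G : Baire →. Baire, Realizes G ConC₁ → Realizes (K.comp (G.comp H)) f)
    {p : Baire} {x : X} (hp : IsName p x) (hx : (f x).Nonempty) :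
    ∃ r ∈ H p, ∃ B : Closeds unitInterval, IsName r B ∧ IsConnected (B : Set unitInterval) ∧
      ∀ z ∈ B, ∀ s, IsName s z → ∃ t ∈ K s, ∃ y ∈ f x, IsName t y := by
  classical
  obtain ⟨G, hG⟩ := exists_realizes_ConC₁
  obtain ⟨q, hq, -⟩ := h G hG p x hp hx
  obtain ⟨s, hs, -⟩ := Part.mem_bind_iff.1 hq
  obtain ⟨r, hr, -⟩ := Part.mem_bind_iff.1 hs
  obtain ⟨B, hB⟩ := exists_isName_closeds r
  have key : ∀ v : Part Baire, Realizes (Function.update G r v) ConC₁ →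
      ∃ s ∈ v, ∃ t ∈ K s, ∃ y ∈ f x, IsName t y := by
    intro v hv
    obtain ⟨t, ht, hy⟩ := h _ hv p x hp hx
    obtain ⟨s, hs, ht⟩ := Part.mem_bind_iff.1 ht
    obtain ⟨r', hr', hs⟩ := Part.mem_bind_iff.1 hs
    obtain rfl := Part.mem_unique hr hr'
    have hu : Function.update G r v r = v := Function.update_self _ _ _
    exact ⟨s, hu ▸ hs, t, ht, hy⟩
  have hBc : IsConnected (B : Set unitInterval) := by
    by_contra hBc
    obtain ⟨s, hs, -⟩ := key Part.none (hG.update r _ fun A hA ⟨y, hy⟩ => by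
      obtain rfl := Represented.unique hA hB
      exact absurd hy.1 hBc)
    exact Part.notMem_none _ hs
  refine ⟨r, hr, B, hB, hBc, fun z hz s hs => ?_⟩
  obtain ⟨s', hs', h'⟩ := key (Part.some s) (hG.update r _ fun A hA _ => by
    obtain rfl := Represented.unique hA hB
    exact ⟨s, Part.mem_some _, z, ⟨hBc, hz⟩, hs⟩)
  rwa [Part.mem_some_iff.1 hs'] at h'

/-- A connected subset of `[0,1]` with more than one point contains a rational point. -/
theorem exists_ratPoint_mem {B : Set unitInterval} (hB : IsPreconnected B)
    (h : ¬ B.Subsingleton) : ∃ k, ratPoint k ∈ B := by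
  obtain ⟨x, hx, y, hy, hxy⟩ := (Set.not_subsingleton_iff.1 h).exists_lt
  obtain ⟨k, hk⟩ := denseRange_ratPoint.exists_mem_open isOpen_Ioo (Set.nonempty_Ioo.2 hxy)
  exact ⟨k, hB.Icc_subset hx hy (Set.Ioo_subset_Icc_self hk)⟩

theorem ratBall_zero : ratBall 0 = ∅ := by simp [ratBall, ratio]

/-- If a closed set is contained in the open set `U`, then this is witnessed by a finite part of
any of its negative names. -/
theorem exists_forall_subset_of_isName {r : Baire} {B : Closeds unitInterval} (hr : IsName r B)
    {U : Set unitInterval} (hU : IsOpen U) (hB : (B : Set unitInterval) ⊆ U) :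
    ∃ N : ℕ, ∀ (r' : Baire) (B' : Closeds unitInterval), IsName r' B' →
      (∀ i < N, r' i = r i) → (B' : Set unitInterval) ⊆ U := by
  have hcov : Uᶜ ⊆ ⋃ i, ratBall (r i) := by
    rw [Set.compl_subset_comm]
    exact (show (B : Set unitInterval) = _ from hr) ▸ hB
  obtain ⟨I, hI⟩ := hU.isClosed_compl.isCompact.elim_finite_subcover _
    (fun _ => Metric.isOpen_ball) hcov
  refine ⟨I.sup id + 1, fun r' B' hr' hag x hx => ?_⟩
  by_contra hxU
  obtain ⟨i, hi, hxi⟩ := Set.mem_iUnion₂.1 (hI hxU)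
  have hx' : x ∈ (⋃ i, ratBall (r' i))ᶜ := (show (B' : Set unitInterval) = _ from hr') ▸ hx
  refine hx' (Set.mem_iUnion.2 ⟨i, ?_⟩)
  rwa [hag i (Nat.lt_succ_of_le (Finset.le_sup (f := id) hi))]

/-- Every closed set is named by names arbitrarily close to the name `000…` of `[0,1]`. -/
theorem exists_isName_tendsto_zero (A : Closeds unitInterval) :
    ∃ q : ℕ → Baire, (∀ m, IsName (q m) A) ∧ Tendsto q atTop (𝓝 (fun _ => 0)) := by
  obtain ⟨q, hq⟩ := Represented.surjective A
  refine ⟨fun m i => if i < m then 0 else q (i - m), fun m => ?_, tendsto_pi_nhds.2 fun i => ?_⟩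
  · refine (show (A : Set unitInterval) = _ from hq).trans (congrArg compl ?_)
    apply Set.Subset.antisymm
    · refine Set.iUnion_subset fun i => ?_
      refine Set.Subset.trans ?_ (Set.subset_iUnion _ (i + m))
      simp
    · refine Set.iUnion_subset fun i => ?_
      beta_reduce
      split_ifs
      · simp [ratBall_zero]
      · exact Set.subset_iUnion (fun i => ratBall (q i)) (i - m)
  · refine tendsto_const_nhds.congr' ?_
    filter_upwards [eventually_gt_atTop i] with m hm
    simp [hm]

theorem isName_zero_top : IsName (fun _ => 0 : Baire) (⊤ : Closeds unitInterval) := by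
  change ((⊤ : Closeds unitInterval) : Set unitInterval) = (⋃ _ : ℕ, ratBall 0)ᶜ
  simp [ratBall_zero]

theorem not_countable_baire : ¬ Countable Baire := by
  intro h
  obtain ⟨f, hf⟩ := exists_surjective_nat Baire
  obtain ⟨n, hn⟩ := hf fun n => f n n + 1
  have := congrFun hn n
  omega

theorem exists_dist_gt (z : unitInterval) : ∃ a : unitInterval, (1 / 4 : ℝ) < dist z a := by
  by_cases h : (1 / 2 : ℝ) ≤ z
  · refine ⟨0, ?_⟩
    rw [Subtype.dist_eq, Real.dist_eq, lt_abs]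
    left
    simp
    linarith
  · refine ⟨1, ?_⟩
    rw [Subtype.dist_eq, Real.dist_eq, lt_abs]
    right
    simp
    linarith

/-- `id × ConC₁` is not strongly Weihrauch reducible to `ConC₁`. -/
theorem not_strongWeihrauchLE_idBaire_prod_ConC₁ :
    ¬ StrongWeihrauchLE (idBaire.prod ConC₁) ConC₁ := by
  rintro ⟨K, H, hK, hH, h⟩
  have key : ∀ (p q : Baire) (A : Closeds unitInterval), IsName q A →
      IsConnected (A : Set unitInterval) →
      ∃ r ∈ H (pair p q), ∃ B : Closeds unitInterval, IsName r B ∧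
        IsConnected (B : Set unitInterval) ∧ ∀ z ∈ B, ∀ s, IsName s z →
          ∃ t, pair p t ∈ K s ∧ ∃ y ∈ A, IsName t y := by
    intro p q A hq hA
    obtain ⟨y₀, hy₀⟩ := hA.nonempty
    obtain ⟨r, hr, B, hB, hBc, hs⟩ := exists_connected_of_realizes h (p := pair p q) (x := (p, A))
      ⟨p, q, rfl, rfl, hq⟩ ⟨(p, y₀), rfl, hA, hy₀⟩
    refine ⟨r, hr, B, hB, hBc, fun z hz s hsz => ?_⟩
    obtain ⟨_, hK, y, hy, p', t, rfl, hp', ht⟩ := hs z hz s hsz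
    obtain rfl : p' = p := Eq.trans hp' hy.1
    exact ⟨t, hK, y.2, hy.2.2, ht⟩
  have htop : IsConnected ((⊤ : Closeds unitInterval) : Set unitInterval) := isConnected_univ
  choose r hr B hB hBc hs using fun p => key p _ _ isName_zero_top htop
  -- The sets `B p` are pairwise disjoint, so one of them has only one point.
  obtain ⟨p, hp⟩ : ∃ p, (B p : Set unitInterval).Subsingleton := by
    by_contra hns
    rw [not_exists] at hns
    choose k hk using fun p => exists_ratPoint_mem (hBc p).isPreconnected
      (hns p)
    refine not_countable_baire (Function.Injective.countable (f := k) fun p p' hpp => ?_)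
    obtain ⟨s, hsz⟩ := Represented.surjective (ratPoint (k p))
    obtain ⟨t, ht, -⟩ := hs p _ (hk p) s hsz
    obtain ⟨t', ht', -⟩ := hs p' _ (hk p') s (hpp ▸ hsz)
    exact pair_left_injective (Part.mem_unique ht ht')
  obtain ⟨x, hx⟩ := (hBc p).nonempty
  obtain ⟨s, hsx, hsU⟩ := exists_isName_forall_nhds x
  obtain ⟨t, ht, -⟩ := hs p x hx s hsx
  obtain ⟨a, ha⟩ := exists_dist_gt (ratPoint (t 2))
  obtain ⟨q, hq, hq0⟩ := exists_isName_tendsto_zero ⟨{a}, isClosed_singleton⟩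
  obtain ⟨V, hVU, hVo, hxV⟩ := eventually_nhds_iff.1 (hsU _ (hK.eventually_apply_eq ht (2 * 2 + 1)))
  obtain ⟨N, hN⟩ := exists_forall_subset_of_isName (hB p) hVo fun z hz => hp hz hx ▸ hxV
  have hev : ∀ᶠ p' in 𝓝 (pair p fun _ => 0), ∀ i ∈ Set.Iio N, ∀ r' ∈ H p', r' i = r p i :=
    (eventually_all_finite (Set.finite_Iio N)).2 fun i _ => hH.eventually_apply_eq (hr p) i
  obtain ⟨m, hm⟩ :=
    (((continuous_pair_right p).continuousAt.tendsto.comp hq0).eventually hev).exists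
  obtain ⟨r', hr', B', hB', hBc', hs'⟩ := key p (q m) _ (hq m) isConnected_singleton
  obtain ⟨x', hx'⟩ := hBc'.nonempty
  obtain ⟨s', hs'U, hsx'⟩ := hVU x' (hN r' B' hB' (fun i hi => hm i hi r' hr') hx')
  obtain ⟨t', ht', y, hy, hty⟩ := hs' x' hx' s' hsx'
  have htt := hs'U _ ht'
  rw [pair_odd, pair_odd] at htt
  obtain rfl : y = a := hy
  have := dist_le_of_isName hty 2
  rw [htt] at this
  norm_num at this ha
  linarith

end ComputableAnalysis

theorem theorem7p5 :
    ¬ ComputableAnalysis.IsCylinder ComputableAnalysis.ConC₁ ∧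
      ¬ ComputableAnalysis.StrongWeihrauchLE
        (ComputableAnalysis.idBaire.prod ComputableAnalysis.ConC₁) ComputableAnalysis.ConC₁ :=
  ⟨fun h => ComputableAnalysis.not_strongWeihrauchLE_idBaire_prod_ConC₁ h.2,
    ComputableAnalysis.not_strongWeihrauchLE_idBaire_prod_ConC₁⟩
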